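/- Let $d\ge 1$, let $X$ be a random vector in $\mathbb R^d$ with a probability density function, and let $f:\mathbb R^d\to\mathbb R^d$ be a map that is almost surely differentiable at $X$ and such that $f(X)$ also has a probability density function. Write $J$ for the Jacobian of $f$ at $X$, a random $d\times d$ matrix with singular values $s_1,\dots,s_d$; put $\mu=\frac1d\sum_i|s_i|$, $\sigma=\sqrt{\frac1d\sum_i(|s_i|-\mu)^2}$ and $\|J\|_{qm}=\sqrt{\frac1d\sum_i s_i^2}$. For a random vector $Y$ in $\mathbb R^d$ with density $q$, let $H(Y)=\mathbb E[-\log q(Y)]\in[-\infty,\infty]$ be its entropy (where it exists) and $E(Y)=\mathbb E[q(Y)^{-1/d}]\in[0,\infty]$ its exponential entropy. Let $\varepsilon\ge0$ and $\delta\in[0,1]$ be such that $\sigma\ge\sqrt{\varepsilon(\varepsilon+2\mu)}$ holds with probability at least $\delta$. Then $$\mathbb E\|J\|_{qm}\ \ge\ \varepsilon\delta+\exp\Big(\tfrac1d\big(H(f(X))-H(X)\big)\Big),$$ whenever the entropies and their difference are defined in $[-\infty,\infty]$ (with $e^{-\infty}=0$, $e^{\infty}=\infty$). If, in addition, the random variable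 $p(X)$, where $p$ is the density of $X$, is independent of $J$, then $$\mathbb E\|J\|_{qm}\ \ge\ \varepsilon\delta+\frac{E(f(X))}{E(X)},$$ where the quotient is read as $0$ if $E(X)=\infty$. All expectations of nonnegative quantities are taken in $[0,\infty]$. -/

import Mathlib

open MeasureTheory ProbabilityTheory
open scoped ENNReal

noncomputable section

namespace ExplodingGradient

/-- The quadratic mean norm of an `m × n` matrix, given as a linear map from `ℝⁿ` to `ℝᵐ`: the
square root of the sum of the squares of its `min m n` singular values, divided by the number `n`
of columns. -/
def qmNorm {m n : ℕ} (A : EuclideanSpace ℝ (Fin n) →ₗ[ℝ] EuclideanSpace ℝ (Fin m)) : ℝ :=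
  √((∑ i ∈ Finset.range (min m n), A.singularValues i ^ 2) / n)

/-- The mean of the absolute values of the `d` singular values of a `d × d` matrix. -/
def meanAbsSV {d : ℕ} (A : EuclideanSpace ℝ (Fin d) →ₗ[ℝ] EuclideanSpace ℝ (Fin d)) : ℝ :=
  (∑ i ∈ Finset.range d, |A.singularValues i|) / d

/-- The standard deviation of the absolute values of the `d` singular values of a
`d × d` matrix. -/
def stdAbsSV {d : ℕ} (A : EuclideanSpace ℝ (Fin d) →ₗ[ℝ] EuclideanSpace ℝ (Fin d)) : ℝ :=
  √((∑ i ∈ Finset.range d, (|A.singularValues i| - meanAbsSV A) ^ 2) / d)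

/-- The Jacobian of `f` at `x`, as a linear map. -/
def jacobian {d : ℕ} (f : EuclideanSpace ℝ (Fin d) → EuclideanSpace ℝ (Fin d))
    (x : EuclideanSpace ℝ (Fin d)) : EuclideanSpace ℝ (Fin d) →ₗ[ℝ] EuclideanSpace ℝ (Fin d) :=
  (fderiv ℝ f x).toLinearMap

/-- The differential entropy `E[-log p(X)]` of a random vector `X` with density `p`, as an extended
real number: the expectation of the positive part of `-log p(X)` minus that of its negative part.
(It is meant for random vectors that have a density. Where both parts have an infinite expectation,
so that the entropy does not exist, the value is `⊥`.) -/
def entropy {Ω : Type*} [MeasurableSpace Ω] {d : ℕ} (X : Ω → EuclideanSpace ℝ (Fin d))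
    (P : Measure Ω) : EReal :=
  ((∫⁻ ω, ENNReal.ofReal (-Real.log (pdf X P volume (X ω)).toReal) ∂P : ℝ≥0∞) : EReal) -
    ((∫⁻ ω, ENNReal.ofReal (Real.log (pdf X P volume (X ω)).toReal) ∂P : ℝ≥0∞) : EReal)

/-- The exponential entropy `E[p(X) ^ (-1/d)]` of a random vector `X` in `ℝᵈ` with density `p`,
as an element of `[0, ∞]`. -/
def expEntropy {Ω : Type*} [MeasurableSpace Ω] {d : ℕ} (X : Ω → EuclideanSpace ℝ (Fin d))
    (P : Measure Ω) : ℝ≥0∞ :=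
  ∫⁻ ω, pdf X P volume (X ω) ^ (-(1 / d : ℝ)) ∂P

end ExplodingGradient

end

/-!
Two facts carry the proof: a pointwise one about matrices, and a change of variables for densities.

*Matrices.* For a `d × d` matrix with singular values `sᵢ`, `qmNorm² = meanAbsSV² + stdAbsSV²`, so
`stdAbsSV ≥ √(ε (ε + 2 meanAbsSV))` forces `qmNorm ≥ ε + meanAbsSV`
(`add_meanAbsSV_le_qmNorm`). By the AM-GM inequality `meanAbsSV ≥ |det| ^ (1/d)`, as `|det|` is the
product of the singular values. Taking expectations, `E[qmNorm J] ≥ ε δ + E[|det J| ^ (1/d)]`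
(`add_lintegral_abs_det_rpow_le`).

*Densities.* If `p` and `q` are the densities of `X` and `f(X)`, then almost surely
`p(X) ≤ q(f(X)) |det J|` (`pdf_le_pdf_comp_mul_abs_det`). For injective `f` this would be an
equality. In general it holds because `f` maps a set `A` to a set of volume at most
`∫_A |det f'|`, whereas `f(X) ∈ f(A)` is at least as likely as `X ∈ A`.

Hence `|det J| ^ (1/d) ≥ exp ((log p(X) - log q(f(X))) / d)`, and Jensen's inequality gives the bound
by the entropies; likewise `q(f(X)) ^ (-1/d) ≤ |det J| ^ (1/d) p(X) ^ (-1/d)`, and if `p(X)` is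
independent of `J` the expectation of the right hand side is a product.
-/

namespace ExplodingGradient

/-! ### Singular values of a square matrix -/

theorem qmNorm_eq {d : ℕ} (A : EuclideanSpace ℝ (Fin d) →ₗ[ℝ] EuclideanSpace ℝ (Fin d)) :
    qmNorm A = √((∑ i ∈ Finset.range d, A.singularValues i ^ 2) / d) := by
  rw [qmNorm, min_self]

/-- The sum of the squares of the singular values is the squared Frobenius norm. It makes the
quadratic mean norm visibly measurable in the matrix. -/
theorem sum_sq_singularValues {d : ℕ}
    (A : EuclideanSpace ℝ (Fin d) →ₗ[ℝ] EuclideanSpace ℝ (Fin d)) :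
    ∑ i ∈ Finset.range d, A.singularValues i ^ 2 =
      ∑ i, ‖A (EuclideanSpace.basisFun (Fin d) ℝ i)‖ ^ 2 := by
  have hd : Module.finrank ℝ (EuclideanSpace ℝ (Fin d)) = d := by simp
  have h := A.isSymmetric_adjoint_comp_self.trace_eq_sum_eigenvalues hd
  rw [← Fin.sum_univ_eq_sum_range (fun i => A.singularValues i ^ 2) d]
  simp_rw [A.sq_singularValues_fin hd]
  refine h.symm.trans ?_
  rw [LinearMap.trace_eq_sum_inner _ (EuclideanSpace.basisFun (Fin d) ℝ)]
  refine Finset.sum_congr rfl fun i _ => ?_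
  rw [LinearMap.comp_apply, LinearMap.adjoint_inner_right, real_inner_self_eq_norm_sq]

theorem measurable_qmNorm_jacobian {d : ℕ}
    (f : EuclideanSpace ℝ (Fin d) → EuclideanSpace ℝ (Fin d)) :
    Measurable fun x => qmNorm (jacobian f x) := by
  simp_rw [qmNorm_eq, sum_sq_singularValues, jacobian]
  have h : ∀ i, Measurable fun x => fderiv ℝ f x (EuclideanSpace.basisFun (Fin d) ℝ i) :=
    fun i => measurable_fderiv_apply_const ℝ f _
  exact ((Finset.measurable_sum _ fun i _ => (h i).norm.pow_const 2).div_const _).sqrt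

theorem qmNorm_nonneg {m n : ℕ} (A : EuclideanSpace ℝ (Fin n) →ₗ[ℝ] EuclideanSpace ℝ (Fin m)) :
    0 ≤ qmNorm A := Real.sqrt_nonneg _

theorem meanAbsSV_nonneg {d : ℕ} (A : EuclideanSpace ℝ (Fin d) →ₗ[ℝ] EuclideanSpace ℝ (Fin d)) :
    0 ≤ meanAbsSV A :=
  div_nonneg (Finset.sum_nonneg fun _ _ => abs_nonneg _) (Nat.cast_nonneg _)

/-- "Second moment = squared mean + variance", for the absolute singular values. -/
theorem qmNorm_sq {d : ℕ} (hd : 0 < d)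
    (A : EuclideanSpace ℝ (Fin d) →ₗ[ℝ] EuclideanSpace ℝ (Fin d)) :
    qmNorm A ^ 2 = meanAbsSV A ^ 2 + stdAbsSV A ^ 2 := by
  have hd' : (d : ℝ) ≠ 0 := by positivity
  rw [qmNorm_eq, stdAbsSV, Real.sq_sqrt (by positivity), Real.sq_sqrt (by positivity)]
  simp_rw [sub_sq, sq_abs, Finset.sum_add_distrib, Finset.sum_sub_distrib, Finset.sum_const,
    Finset.card_range, nsmul_eq_mul]
  have h : ∑ i ∈ Finset.range d, 2 * |A.singularValues i| * meanAbsSV A =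
      2 * (d * meanAbsSV A) * meanAbsSV A := by
    rw [← Finset.sum_mul, ← Finset.mul_sum, meanAbsSV, mul_div_cancel₀ _ hd']
  rw [h]
  field_simp
  ring

theorem meanAbsSV_le_qmNorm {d : ℕ} (hd : 0 < d)
    (A : EuclideanSpace ℝ (Fin d) →ₗ[ℝ] EuclideanSpace ℝ (Fin d)) :
    meanAbsSV A ≤ qmNorm A := by
  refine le_of_sq_le_sq ?_ (qmNorm_nonneg A)
  rw [qmNorm_sq hd]
  exact le_add_of_nonneg_right (sq_nonneg _)

/-- The AM-GM inequality for the singular values. -/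
theorem abs_det_rpow_le_meanAbsSV {d : ℕ} (hd : 0 < d)
    (A : EuclideanSpace ℝ (Fin d) →ₗ[ℝ] EuclideanSpace ℝ (Fin d)) :
    |LinearMap.det A| ^ (1 / d : ℝ) ≤ meanAbsSV A := by
  have h := Real.geom_mean_le_arith_mean (Finset.range d) (fun _ => 1)
    (fun i => |A.singularValues i|) (fun _ _ => zero_le_one) (by simpa using hd)
    (fun _ _ => abs_nonneg _)
  rw [← LinearMap.normDet_eq_abs_det, LinearMap.normDet_eq_prod_singularValues]
  simpa [meanAbsSV, abs_of_nonneg (A.singularValues_nonneg _)] using h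

/-- A large spread of the singular values separates their quadratic mean from their mean. No sign
condition on `ε` is needed. -/
theorem add_meanAbsSV_le_qmNorm {d : ℕ} (hd : 0 < d)
    (A : EuclideanSpace ℝ (Fin d) →ₗ[ℝ] EuclideanSpace ℝ (Fin d)) {ε : ℝ}
    (h : √(ε * (ε + 2 * meanAbsSV A)) ≤ stdAbsSV A) :
    ε + meanAbsSV A ≤ qmNorm A := by
  have hμ := meanAbsSV_nonneg A
  refine le_of_sq_le_sq ?_ (qmNorm_nonneg A)
  have h2 := (Real.sqrt_le_left (Real.sqrt_nonneg _)).1 h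
  rw [← stdAbsSV] at h2
  rw [qmNorm_sq hd]
  linarith

/-! ### Jensen's inequality for extended real expectations -/

/-- `exp (c (E u - E v)) ≤ E exp (c (u - v))`, where `E u` and `E v` are the differences of the
expectations of the positive and negative parts in the extended reals.

No integrability is assumed. The convention `⊤ - ⊤ = ⊥` is harmless: if the right hand side is
finite, so is `E (u - v)⁺`, whence `E u⁻ < ∞` implies `E v⁻ < ∞`, and `E v⁺ < ∞` implies
`E u⁺ < ∞`. So if an expectation of a positive or negative part is infinite, then the exponent on
the left is `⊥`. -/
theorem exp_mul_sub_le_lintegral {Ω : Type*} [MeasurableSpace Ω] {P : Measure Ω}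
    [IsProbabilityMeasure P] {u v : Ω → ℝ} (hu : AEMeasurable u P) (hv : AEMeasurable v P)
    {c : ℝ} (hc : 0 < c) :
    EReal.exp ((c : EReal) *
      ((((∫⁻ ω, ENNReal.ofReal (u ω) ∂P : ℝ≥0∞) : EReal) -
          ((∫⁻ ω, ENNReal.ofReal (-u ω) ∂P : ℝ≥0∞) : EReal)) -
        (((∫⁻ ω, ENNReal.ofReal (v ω) ∂P : ℝ≥0∞) : EReal) -
          ((∫⁻ ω, ENNReal.ofReal (-v ω) ∂P : ℝ≥0∞) : EReal)))) ≤
      ∫⁻ ω, ENNReal.ofReal (Real.exp (c * (u ω - v ω))) ∂P := by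
  rcases eq_or_ne (∫⁻ ω, ENNReal.ofReal (Real.exp (c * (u ω - v ω))) ∂P) ∞ with hI | hI
  · simp [hI]
  -- The positive part of `u - v` is integrable because `t ≤ exp (c t) / c`.
  have hK : ∫⁻ ω, ENNReal.ofReal (u ω - v ω) ∂P ≠ ∞ := by
    refine ne_top_of_le_ne_top (ENNReal.mul_ne_top (ENNReal.ofReal_ne_top (r := c⁻¹)) hI) ?_
    rw [← lintegral_const_mul' _ _ ENNReal.ofReal_ne_top]
    refine lintegral_mono fun ω => ?_
    rw [← ENNReal.ofReal_mul (by positivity)]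
    refine ENNReal.ofReal_le_ofReal ?_
    rw [← div_eq_inv_mul, le_div_iff₀ hc]
    linarith [Real.add_one_le_exp (c * (u ω - v ω))]
  have htri : ∀ {a b : Ω → ℝ}, AEMeasurable b P → (∀ ω, a ω ≤ b ω + (u ω - v ω)) →
      ∫⁻ ω, ENNReal.ofReal (b ω) ∂P ≠ ∞ → ∫⁻ ω, ENNReal.ofReal (a ω) ∂P ≠ ∞ := by
    intro a b hb hab hbt
    refine ne_top_of_le_ne_top (ENNReal.add_ne_top.2 ⟨hbt, hK⟩) ?_
    rw [← lintegral_add_left' hb.ennreal_ofReal]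
    exact lintegral_mono fun ω =>
      (ENNReal.ofReal_le_ofReal (hab ω)).trans ENNReal.ofReal_add_le
  -- If `E u⁻ = ∞` then `E u = ⊥`, even if `E u⁺ = ∞`, and the left hand side vanishes.
  rcases eq_or_ne (∫⁻ ω, ENNReal.ofReal (-u ω) ∂P) ∞ with hb | hb
  · simp [hb, EReal.coe_mul_bot_of_pos hc]
  have he := htri (a := fun ω => -v ω) hu.neg (fun ω => by simp) hb
  -- If `E v⁺ = ∞` then `E v = ⊤`, as `E v⁻ < ∞`, and the left hand side vanishes again.
  rcases eq_or_ne (∫⁻ ω, ENNReal.ofReal (v ω) ∂P) ∞ with hv' | hv'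
  · lift (∫⁻ ω, ENNReal.ofReal (-v ω) ∂P) to NNReal using he with e
    have : (⊤ : EReal) - ((e : ℝ≥0∞) : EReal) = ⊤ := EReal.top_sub_coe e
    simp [hv', this, EReal.coe_mul_bot_of_pos hc]
  have ha := htri (a := u) hv (fun ω => by simp) hv'
  have hint : ∀ {w : Ω → ℝ}, AEMeasurable w P → ∫⁻ ω, ENNReal.ofReal (w ω) ∂P ≠ ∞ →
      ∫⁻ ω, ENNReal.ofReal (-w ω) ∂P ≠ ∞ → Integrable w P ∧
      ((∫⁻ ω, ENNReal.ofReal (w ω) ∂P : ℝ≥0∞) : EReal) -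
        ((∫⁻ ω, ENNReal.ofReal (-w ω) ∂P : ℝ≥0∞) : EReal) = ((∫ ω, w ω ∂P : ℝ) : EReal) := by
    intro w hw h1 h2
    have hwi : Integrable w P := by
      refine ⟨hw.aestronglyMeasurable, ?_⟩
      rw [hasFiniteIntegral_iff_norm]
      refine lt_top_iff_ne_top.2 (ne_top_of_le_ne_top (ENNReal.add_ne_top.2 ⟨h1, h2⟩) ?_)
      rw [← lintegral_add_left' hw.ennreal_ofReal]
      refine lintegral_mono fun ω => ?_
      rcases le_total 0 (w ω) with h | h
      · rw [Real.norm_of_nonneg h]; exact le_self_add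
      · rw [Real.norm_of_nonpos h]; exact le_add_self
    refine ⟨hwi, ?_⟩
    rw [integral_eq_lintegral_pos_part_sub_lintegral_neg_part hwi, EReal.coe_sub]
    lift (∫⁻ ω, ENNReal.ofReal (w ω) ∂P) to NNReal using h1 with r
    lift (∫⁻ ω, ENNReal.ofReal (-w ω) ∂P) to NNReal using h2 with s
    rfl
  obtain ⟨hui, hue⟩ := hint hu ha hb
  obtain ⟨hvi, hve⟩ := hint hv hv' he
  rw [hue, hve, ← EReal.coe_sub, ← EReal.coe_mul, EReal.exp_coe, ← integral_sub hui hvi,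
    ← integral_const_mul]
  have hexp : Integrable (fun ω => Real.exp (c * (u ω - v ω))) P := by
    refine ⟨(((hu.sub hv).const_mul c).exp).aestronglyMeasurable, ?_⟩
    rw [hasFiniteIntegral_iff_ofReal (Filter.Eventually.of_forall fun _ => (Real.exp_pos _).le)]
    exact lt_top_iff_ne_top.2 hI
  rw [← ofReal_integral_eq_lintegral_ofReal hexp
    (Filter.Eventually.of_forall fun _ => (Real.exp_pos _).le)]
  exact ENNReal.ofReal_le_ofReal (convexOn_exp.map_integral_le Real.continuous_exp.continuousOn
    isClosed_univ (by simp) ((hui.sub hvi).const_mul c) hexp)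

/-! ### Densities under a differentiable map -/

/-- The area inequality as an inequality of measures. The set `f '' A` need not be measurable;
only its traces on measurable sets are measured. -/
theorem restrict_image_le_map {d : ℕ} {f : EuclideanSpace ℝ (Fin d) → EuclideanSpace ℝ (Fin d)}
    {A : Set (EuclideanSpace ℝ (Fin d))} (hA : MeasurableSet A)
    (hf : ∀ x ∈ A, DifferentiableAt ℝ f x) :
    volume.restrict (f '' A) ≤
      ((volume.restrict A).withDensity fun x => ENNReal.ofReal |(fderiv ℝ f x).det|).map f := by
  have hcont : ContinuousOn f A := fun x hx => (hf x hx).continuousAt.continuousWithinAt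
  have hfm : AEMeasurable f (volume.restrict A) := hcont.aemeasurable hA
  have hfm' := hfm.mono_ac (withDensity_absolutelyContinuous _
    fun x => ENNReal.ofReal |(fderiv ℝ f x).det|)
  refine Measure.le_iff.2 fun Q hQ => ?_
  have hAQ : MeasurableSet (f ⁻¹' Q ∩ A) := by
    have := MeasurableSet.subtype_image hA (hcont.domRestrict.measurable hQ)
    rwa [Set.domRestrict_eq, Set.preimage_comp, Subtype.image_preimage_coe, Set.inter_comm] at this
  rw [Measure.restrict_apply hQ, Measure.map_apply_of_aemeasurable hfm' hQ,
    withDensity_apply', Set.inter_comm, ← Set.image_inter_preimage, Set.inter_comm A,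
    Measure.restrict_restrict₀' hA.nullMeasurableSet]
  exact addHaar_image_le_lintegral_abs_det_fderiv volume hAQ fun x hx =>
    (hf x hx.2).hasFDerivAt.hasFDerivWithinAt

/-- The densities `p` of `X` and `q` of `f(X)` satisfy `p(X) ≤ q(f(X)) |det f'(X)|` almost surely.
Neither injectivity nor measurability of `f` is assumed: only the points of differentiability
matter, and they form a measurable set on which `f` is continuous. -/
theorem pdf_le_pdf_comp_mul_abs_det {Ω : Type*} [MeasurableSpace Ω] {P : Measure Ω} {d : ℕ}
    {X : Ω → EuclideanSpace ℝ (Fin d)} (hX : HasPDF X P volume)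
    {f : EuclideanSpace ℝ (Fin d) → EuclideanSpace ℝ (Fin d)}
    (hf : ∀ᵐ ω ∂P, DifferentiableAt ℝ f (X ω))
    (hfX : HasPDF (fun ω => f (X ω)) P volume) :
    ∀ᵐ ω ∂P, pdf X P volume (X ω) ≤
      pdf (fun ω => f (X ω)) P volume (f (X ω)) * ENNReal.ofReal |(fderiv ℝ f (X ω)).det| := by
  set p := pdf X P volume
  set q := pdf (fun ω => f (X ω)) P volume
  have hD : MeasurableSet {x | DifferentiableAt ℝ f x} := measurableSet_of_differentiableAt ℝ f
  have hJm : Measurable fun x => ENNReal.ofReal |(fderiv ℝ f x).det| :=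
    (continuous_abs.measurable.comp
      (ContinuousLinearMap.continuous_det.measurable.comp (measurable_fderiv ℝ f))).ennreal_ofReal
  have hXm : AEMeasurable X P := HasPDF.aemeasurable X P volume
  have key : ∀ᵐ x ∂volume.restrict {x | DifferentiableAt ℝ f x},
      p x ≤ q (f x) * ENNReal.ofReal |(fderiv ℝ f x).det| := by
    refine ae_le_of_forall_setLIntegral_le_of_sigmaFinite (measurable_pdf X P volume)
      fun s hs _ => ?_
    rw [Measure.restrict_restrict hs]
    have hA := hs.inter hD
    have hfA : ∀ x ∈ s ∩ {x | DifferentiableAt ℝ f x}, DifferentiableAt ℝ f x := fun x hx => hx.2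
    generalize s ∩ {x | DifferentiableAt ℝ f x} = A at hA hfA
    have hfm : AEMeasurable f (volume.restrict A) :=
      ContinuousOn.aemeasurable
        (fun x hx => (hfA x hx).continuousAt.continuousWithinAt) hA
    have hqm : Measurable q := measurable_pdf _ P volume
    calc ∫⁻ x in A, p x
        = P (X ⁻¹' A) := by
          rw [← map_eq_setLIntegral_pdf X P volume hA, Measure.map_apply_of_aemeasurable hXm hA]
      _ ≤ P ((fun ω => f (X ω)) ⁻¹' (f '' A)) :=
          measure_mono fun ω hω => Set.mem_image_of_mem f hω
      _ ≤ P.map (fun ω => f (X ω)) (f '' A) :=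
          Measure.le_map_apply (HasPDF.aemeasurable _ P volume) _
      _ = ∫⁻ y in f '' A, q y := by
          rw [map_eq_withDensity_pdf (fun ω => f (X ω)) P volume, withDensity_apply']
      _ ≤ ∫⁻ y, q y ∂((volume.restrict A).withDensity
            fun x => ENNReal.ofReal |(fderiv ℝ f x).det|).map f :=
          lintegral_mono' (restrict_image_le_map hA hfA) le_rfl
      _ = ∫⁻ x in A, q (f x) * ENNReal.ofReal |(fderiv ℝ f x).det| := by
          rw [lintegral_map' hqm.aemeasurable
              (hfm.mono_ac (withDensity_absolutelyContinuous _ _)),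
            lintegral_withDensity_eq_lintegral_mul₀ hJm.aemeasurable
              (g := fun x => q (f x)) (hqm.comp_aemeasurable hfm)]
          exact lintegral_congr fun x => mul_comm _ _
  rw [ae_restrict_iff' hD] at key
  filter_upwards [hf, ae_of_ae_map hXm (hX.absolutelyContinuous.ae_le key)] with ω h1 h2
  exact h2 h1

/-- A density is almost surely nonzero at the random point itself. -/
theorem ae_pdf_pos {Ω E : Type*} [MeasurableSpace Ω] [MeasurableSpace E] {P : Measure Ω}
    {μ : Measure E} {X : Ω → E} (hX : HasPDF X P μ) : ∀ᵐ ω ∂P, pdf X P μ (X ω) ≠ 0 := by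
  refine ae_of_ae_map (HasPDF.aemeasurable X P μ) (p := fun x => pdf X P μ x ≠ 0) ?_
  rw [map_eq_withDensity_pdf X P μ, ae_withDensity_iff (measurable_pdf X P μ)]
  exact Filter.Eventually.of_forall fun _ h => h

theorem ae_pdf_lt_top {Ω E : Type*} [MeasurableSpace Ω] [MeasurableSpace E] {P : Measure Ω}
    [IsFiniteMeasure P] {μ : Measure E} {X : Ω → E} (hX : HasPDF X P μ) :
    ∀ᵐ ω ∂P, pdf X P μ (X ω) < ∞ :=
  ae_of_ae_map (HasPDF.aemeasurable X P μ) (hX.absolutelyContinuous.ae_le pdf.ae_lt_top)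

/-! ### Lower bounds for the expected quadratic mean norm -/

/-- The expectation form of the matrix inequality. The event in `hδ` enters through its outer
measure, so its measurability plays no role. -/
theorem add_lintegral_abs_det_rpow_le {Ω : Type*} [MeasurableSpace Ω] {P : Measure Ω}
    [IsFiniteMeasure P] {d : ℕ} (hd : 0 < d) {X : Ω → EuclideanSpace ℝ (Fin d)}
    (hX : AEMeasurable X P) (f : EuclideanSpace ℝ (Fin d) → EuclideanSpace ℝ (Fin d))
    {ε δ : ℝ} (hδ0 : 0 ≤ δ)
    (hδ : δ ≤ P.real {ω | √(ε * (ε + 2 * meanAbsSV (jacobian f (X ω)))) ≤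
        stdAbsSV (jacobian f (X ω))}) :
    ENNReal.ofReal (ε * δ) + ∫⁻ ω, ENNReal.ofReal |(fderiv ℝ f (X ω)).det| ^ (1 / d : ℝ) ∂P ≤
      ∫⁻ ω, ENNReal.ofReal (qmNorm (jacobian f (X ω))) ∂P := by
  have hdet : ∀ ω, ENNReal.ofReal |(fderiv ℝ f (X ω)).det| ^ (1 / d : ℝ) ≤
      ENNReal.ofReal (meanAbsSV (jacobian f (X ω))) := fun ω => by
    rw [ENNReal.ofReal_rpow_of_nonneg (abs_nonneg _) (by positivity)]
    exact ENNReal.ofReal_le_ofReal (abs_det_rpow_le_meanAbsSV hd (jacobian f (X ω)))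
  have hqm : AEMeasurable (fun ω => ENNReal.ofReal (qmNorm (jacobian f (X ω)))) P :=
    ((measurable_qmNorm_jacobian f).comp_aemeasurable hX).ennreal_ofReal
  have hgm : AEMeasurable
      (fun ω => ENNReal.ofReal |(fderiv ℝ f (X ω)).det| ^ (1 / d : ℝ)) P :=
    ((continuous_abs.measurable.comp (ContinuousLinearMap.continuous_det.measurable.comp
      (measurable_fderiv ℝ f))).comp_aemeasurable hX).ennreal_ofReal.pow_const _
  rcases lt_or_ge ε 0 with hε | hε
  · rw [ENNReal.ofReal_of_nonpos (mul_nonpos_of_nonpos_of_nonneg hε.le hδ0), zero_add]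
    exact lintegral_mono fun ω => (hdet ω).trans
      (ENNReal.ofReal_le_ofReal (meanAbsSV_le_qmNorm hd _))
  -- `T` contains the event in `hδ` and, unlike it, is defined by measurable functions.
  set T := {ω | ENNReal.ofReal ε + ENNReal.ofReal |(fderiv ℝ f (X ω)).det| ^ (1 / d : ℝ) ≤
    ENNReal.ofReal (qmNorm (jacobian f (X ω)))}
  have hTm : NullMeasurableSet T P := nullMeasurableSet_le (hgm.const_add _) hqm
  have hδT : ENNReal.ofReal δ ≤ P T := by
    rw [ENNReal.ofReal_le_iff_le_toReal (measure_ne_top P T)]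
    refine hδ.trans (measureReal_mono fun ω hω => ?_)
    refine (add_le_add_right (hdet ω) _).trans ?_
    rw [← ENNReal.ofReal_add hε (meanAbsSV_nonneg _)]
    exact ENNReal.ofReal_le_ofReal (add_meanAbsSV_le_qmNorm hd _ hω)
  calc ENNReal.ofReal (ε * δ) +
        ∫⁻ ω, ENNReal.ofReal |(fderiv ℝ f (X ω)).det| ^ (1 / d : ℝ) ∂P
      ≤ ∫⁻ ω, T.indicator (fun _ => ENNReal.ofReal ε) ω ∂P +
        ∫⁻ ω, ENNReal.ofReal |(fderiv ℝ f (X ω)).det| ^ (1 / d : ℝ) ∂P := by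
        rw [lintegral_indicator_const₀ hTm, ENNReal.ofReal_mul hε]
        gcongr
    _ = ∫⁻ ω, T.indicator (fun _ => ENNReal.ofReal ε) ω +
        ENNReal.ofReal |(fderiv ℝ f (X ω)).det| ^ (1 / d : ℝ) ∂P :=
        (lintegral_add_right' _ hgm).symm
    _ ≤ ∫⁻ ω, ENNReal.ofReal (qmNorm (jacobian f (X ω))) ∂P := by
        refine lintegral_mono fun ω => ?_
        by_cases hω : ω ∈ T
        · rw [Set.indicator_of_mem hω]
          exact hω
        · rw [Set.indicator_of_notMem hω, zero_add]
          exact (hdet ω).trans (ENNReal.ofReal_le_ofReal (meanAbsSV_le_qmNorm hd _))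

/-- The entropy gained by applying `f` is controlled by the expected `d`-th root of the absolute
Jacobian determinant. -/
theorem exp_entropy_sub_le_lintegral {Ω : Type*} [MeasurableSpace Ω] {P : Measure Ω}
    [IsProbabilityMeasure P] {d : ℕ} (hd : 0 < d)
    {X : Ω → EuclideanSpace ℝ (Fin d)} (hX : HasPDF X P volume)
    {f : EuclideanSpace ℝ (Fin d) → EuclideanSpace ℝ (Fin d)}
    (hf : ∀ᵐ ω ∂P, DifferentiableAt ℝ f (X ω))
    (hfX : HasPDF (fun ω => f (X ω)) P volume) :
    EReal.exp (((1 / d : ℝ) : EReal) * (entropy (fun ω => f (X ω)) P - entropy X P)) ≤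
      ∫⁻ ω, ENNReal.ofReal |(fderiv ℝ f (X ω)).det| ^ (1 / d : ℝ) ∂P := by
  have hm : ∀ {Y : Ω → EuclideanSpace ℝ (Fin d)}, HasPDF Y P volume →
      AEMeasurable (fun ω => -Real.log (pdf Y P volume (Y ω)).toReal) P := fun hY =>
    ((measurable_pdf _ P volume).comp_aemeasurable
      (HasPDF.aemeasurable _ P volume)).ennreal_toReal.log.neg
  have hc : (0 : ℝ) < 1 / d := by positivity
  have h := exp_mul_sub_le_lintegral (hm hfX) (hm hX) hc
  simp only [neg_neg] at h
  refine h.trans (lintegral_mono_ae ?_)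
  filter_upwards [pdf_le_pdf_comp_mul_abs_det hX hf hfX, ae_pdf_pos hX, ae_pdf_lt_top hX,
    ae_pdf_pos hfX, ae_pdf_lt_top hfX] with ω hle hp0 hp hq0 hq
  generalize pdf X P volume (X ω) = p at *
  generalize pdf (fun ω => f (X ω)) P volume (f (X ω)) = q at *
  rw [ENNReal.ofReal_rpow_of_nonneg (abs_nonneg _) hc.le]
  refine ENNReal.ofReal_le_ofReal ?_
  have hp' := ENNReal.toReal_pos hp0 hp.ne
  have hq' := ENNReal.toReal_pos hq0 hq.ne
  have hle' : p.toReal ≤ q.toReal * |(fderiv ℝ f (X ω)).det| := by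
    have := ENNReal.toReal_mono (ENNReal.mul_ne_top hq.ne ENNReal.ofReal_ne_top) hle
    rwa [ENNReal.toReal_mul, ENNReal.toReal_ofReal (abs_nonneg _)] at this
  have heq : Real.exp (1 / d * (-Real.log q.toReal - -Real.log p.toReal)) =
      (p.toReal / q.toReal) ^ (1 / d : ℝ) := by
    rw [Real.rpow_def_of_pos (by positivity), Real.log_div hp'.ne' hq'.ne']
    ring_nf
  rw [heq]
  exact Real.rpow_le_rpow (by positivity) ((div_le_iff₀' hq').2 hle') hc.le

/-- The growth factor of the exponential entropy is controlled by the expected `d`-th root of the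
absolute Jacobian determinant, if the Jacobian is independent of `p(X)`. -/
theorem expEntropy_comp_le {Ω : Type*} [MeasurableSpace Ω] {P : Measure Ω}
    [IsFiniteMeasure P] {d : ℕ}
    {X : Ω → EuclideanSpace ℝ (Fin d)} (hX : HasPDF X P volume)
    {f : EuclideanSpace ℝ (Fin d) → EuclideanSpace ℝ (Fin d)}
    (hf : ∀ᵐ ω ∂P, DifferentiableAt ℝ f (X ω))
    (hfX : HasPDF (fun ω => f (X ω)) P volume)
    (hind : IndepFun (fun ω => pdf X P volume (X ω)) (fun ω => fderiv ℝ f (X ω)) P) :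
    expEntropy (fun ω => f (X ω)) P ≤
      (∫⁻ ω, ENNReal.ofReal |(fderiv ℝ f (X ω)).det| ^ (1 / d : ℝ) ∂P) * expEntropy X P := by
  have hXm : AEMeasurable X P := HasPDF.aemeasurable X P volume
  have hc : (0 : ℝ) ≤ 1 / d := by positivity
  have hφ : Measurable fun x : ℝ≥0∞ => x ^ (-(1 / d : ℝ)) := measurable_id.pow_const _
  have hψ : Measurable fun L : EuclideanSpace ℝ (Fin d) →L[ℝ] EuclideanSpace ℝ (Fin d) =>
      ENNReal.ofReal |L.det| ^ (1 / d : ℝ) :=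
    (continuous_abs.measurable.comp
      ContinuousLinearMap.continuous_det.measurable).ennreal_ofReal.pow_const _
  have hmul := lintegral_mul_eq_lintegral_mul_lintegral_of_indepFun''
    ((hψ.comp (measurable_fderiv ℝ f)).comp_aemeasurable hXm)
    ((hφ.comp (measurable_pdf X P volume)).comp_aemeasurable hXm) (hind.comp hφ hψ).symm
  refine le_of_le_of_eq ?_ hmul
  refine lintegral_mono_ae ?_
  filter_upwards [pdf_le_pdf_comp_mul_abs_det hX hf hfX, ae_pdf_pos hX, ae_pdf_lt_top hX,
    ae_pdf_pos hfX, ae_pdf_lt_top hfX] with ω hle hp0 hp hq0 hq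
  have h := ENNReal.rpow_le_rpow hle hc
  rw [ENNReal.mul_rpow_of_nonneg _ _ hc] at h
  simp only [Function.comp_apply]
  rw [ENNReal.rpow_neg, ENNReal.rpow_neg, ← div_eq_mul_inv,
    ENNReal.le_div_iff_mul_le (.inl (ENNReal.rpow_pos hp0.bot_lt hp.ne).ne')
      (.inl (ENNReal.rpow_ne_top_of_nonneg hc hp.ne)),
    ENNReal.inv_mul_le_iff (ENNReal.rpow_pos hq0.bot_lt hq.ne).ne'
      (ENNReal.rpow_ne_top_of_nonneg hc hq.ne)]
  exact h

end ExplodingGradient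

theorem theorem3 {Ω : Type*} [MeasurableSpace Ω] (P : Measure Ω) [IsProbabilityMeasure P]
    {d : ℕ} (hd : 0 < d)
    (X : Ω → EuclideanSpace ℝ (Fin d)) (hX : HasPDF X P volume)
    (f : EuclideanSpace ℝ (Fin d) → EuclideanSpace ℝ (Fin d))
    (hf : ∀ᵐ ω ∂P, DifferentiableAt ℝ f (X ω))
    (hfX : HasPDF (fun ω => f (X ω)) P volume)
    (ε δ : ℝ) (hδ0 : 0 ≤ δ)
    (hδ : δ ≤ P.real {ω | √(ε * (ε + 2 * ExplodingGradient.meanAbsSV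
        (ExplodingGradient.jacobian f (X ω)))) ≤
        ExplodingGradient.stdAbsSV (ExplodingGradient.jacobian f (X ω))}) :
    ENNReal.ofReal (ε * δ) +
        EReal.exp (((1 / d : ℝ) : EReal) *
          (ExplodingGradient.entropy (fun ω => f (X ω)) P - ExplodingGradient.entropy X P)) ≤
      ∫⁻ ω, ENNReal.ofReal (ExplodingGradient.qmNorm (ExplodingGradient.jacobian f (X ω))) ∂P ∧
    (IndepFun (fun ω => pdf X P volume (X ω)) (fun ω => fderiv ℝ f (X ω)) P →
      ENNReal.ofReal (ε * δ) +
          ExplodingGradient.expEntropy (fun ω => f (X ω)) P / ExplodingGradient.expEntropy X P ≤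
        ∫⁻ ω, ENNReal.ofReal (ExplodingGradient.qmNorm (ExplodingGradient.jacobian f (X ω))) ∂P) := by
  have hXm : AEMeasurable X P := HasPDF.aemeasurable X P volume
  have hmain := ExplodingGradient.add_lintegral_abs_det_rpow_le hd hXm f hδ0 hδ
  refine ⟨le_trans ?_ hmain, fun hind => le_trans ?_ hmain⟩
  · gcongr
    exact ExplodingGradient.exp_entropy_sub_le_lintegral hd hX hf hfX
  · gcongr
    -- Where `E(X) = ∞` the quotient is `0`.
    exact ENNReal.div_le_of_le_mul (ExplodingGradient.expEntropy_comp_le hX hf hfX hind)
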